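/- Let $\mathbb{F}_q$ be a finite field with $q$ elements, $A=\mathbb{F}_q[\theta]$, $K=\mathbb{F}_q(\theta)$ and $K_\infty=\mathbb{F}_q((1/\theta))$. For positive integers $n_1,\dots,n_r$ ($r\ge 1$) and $d\ge 0$ put $$S_d(n_1,\dots,n_r)=\sum_{\substack{a_1,\dots,a_r\in A\ \text{monic}\\ d=\deg a_1>\cdots>\deg a_r}}\frac1{a_1^{n_1}\cdots a_r^{n_r}}\in K,\qquad \zeta_A(n_1,\dots,n_r)=\sum_{\substack{a_1,\dots,a_r\in A\ \text{monic}\\ \deg a_1>\cdots>\deg a_r}}\frac1{a_1^{n_1}\cdots a_r^{n_r}}\in K_\infty ,$$ the latter series being convergent. The weight of $(n_1,\dots,n_r)$ is $n_1+\cdots+n_r$. For $w\ge 1$ let $\boldsymbol{C}_w(K)$ be the free $K$-vector space on the symbols $[n_1,\dots,n_r]$ of weight $w$ ($r\ge 1$, $n_i\geq 1$), let $\zeta_A$ and $S_d$ also denote the $K$-linear maps $\boldsymbol{C}_w(K)\to K_\infty$ with $[n_1,\dots,n_r]\mapsto\zeta_A(n_1,\dots,n_r)$, respectively $S_d(n_1,\dots,n_r)$,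 and let $\mathcal{Z}_w(K)=\zeta_A(\boldsymbol{C}_w(K))$. Let $D_i=\prod_{j=0}^{i-1}(\theta^{q^i}-\theta^{q^j})$. **Theorem.** For every integer $k>0$, the series over $d$ in $$\Xi_k=\frac1{D_k}\sum_{j=1}^k(-1)^{k+j}D_j^{q^{k-j}}\sum_{d\ge0}S_d(1)\,S_d\bigl(q^{k-j},q^{k-j}(q-1),q^{k-j+1}(q-1),\dots,q^{k-1}(q-1)\bigr)$$ converge in $K_\infty$, one has $\Xi_k\in\mathcal{Z}_{q^k+1}(K)$, and $$\zeta_A\bigl(1,1,q-1,q(q-1),\dots,q^{k-1}(q-1)\bigr)+\frac{(-1)^{k+1}}{D_k}\zeta_A(1,q^k)+\Xi_k=0 .$$ This is a non-trivial $K$-linear relation of weight $q^k+1$ in the following sense. There are $L_1,\dots,L_k\in\boldsymbol{C}_{q^k+1}(K)$, with coefficients in the prime field $\mathbb{F}_p$, such that $S_d(L_j)=S_d(1)S_d(q^{k-j},q^{k-j}(q-1),\dots,q^{k-1}(q-1))$ for all $d\ge0$ and $1\le j\le k$; with $X_k=\frac1{D_k}\sum_{j=1}^k(-1)^{k+j}D_j^{q^{k-j}}L_j$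 one has $\zeta_A(X_k)=\Xi_k$, and the element $$[1,1,q-1,\dots,q^{k-1}(q-1)]+\frac{(-1)^{k+1}}{D_k}[1,q^k]+X_k$$ of $\boldsymbol{C}_{q^k+1}(K)$ is non-zero and is mapped to $0$ by $\zeta_A$. -/

import Mathlib

open Polynomial

namespace ThakurMZV

noncomputable section

/-- The local field `K_∞ = F((1/θ))`: the completion of the rational function field `K = F(θ)`
(`RatFunc F`, with `θ = RatFunc.X`) for the valuation at infinity. -/
abbrev Kinf (F : Type*) [Field F] [DecidableEq (RatFunc F)] : Type _ :=
  RatFunc.CompletionAtInfty F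

/-- The tuples `(a₁, …, a_r)` of monic polynomials with `deg a₁ > ⋯ > deg a_r`. -/
def tuples (F : Type*) [Field F] (r : ℕ) : Set (Fin r → F[X]) :=
  {a | (∀ i, (a i).Monic) ∧ StrictAnti fun i => (a i).natDegree}

/-- The degree of the first entry of a tuple (and `0` for the empty tuple). -/
def leadDeg {F : Type*} [Field F] {r : ℕ} (a : Fin r → F[X]) : ℕ :=
  if h : 0 < r then (a ⟨0, h⟩).natDegree else 0

/-- The tuples of monic polynomials with `d = deg a₁ > ⋯ > deg a_r`. -/
def tuplesOfDeg (F : Type*) [Field F] (r d : ℕ) : Set (Fin r → F[X]) :=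
  {a | a ∈ tuples F r ∧ leadDeg a = d}

theorem finite_tuplesOfDeg (F : Type*) [Field F] [Finite F] (r d : ℕ) :
    (tuplesOfDeg F r d).Finite := by
  have h1 : {p : F[X] | p.natDegree ≤ d}.Finite := by
    have : Finite (degreeLT F (d + 1)) := Finite.of_equiv _ (degreeLTEquiv F (d + 1)).toEquiv.symm
    refine (Set.toFinite (degreeLT F (d + 1) : Set F[X])).subset fun p hp => ?_
    exact mem_degreeLT.2 (lt_of_le_of_lt degree_le_natDegree
      (by exact_mod_cast Nat.lt_succ_of_le hp))
  refine (Set.Finite.pi' (fun _ : Fin r => h1)).subset fun a ha i => ?_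
  have hr : 0 < r := i.pos
  have h2 := ha.2
  rw [leadDeg, dif_pos hr] at h2
  exact (ha.1.2.antitone (show (⟨0, hr⟩ : Fin r) ≤ i from Nat.zero_le _)).trans h2.le

/-- For `s = (n₁, …, n_r)` and a tuple `a`, the element `1 / (a₁ ^ n₁ ⋯ a_r ^ n_r)` of `K`,
viewed in `K_∞`. -/
def term (F : Type*) [Field F] [DecidableEq (RatFunc F)] (s : List ℕ)
    (a : Fin s.length → F[X]) : Kinf F :=
  algebraMap (RatFunc F) (Kinf F) (∏ i, (algebraMap F[X] (RatFunc F) (a i) ^ s.get i)⁻¹)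

/-- The multiple power sum `S_d(n₁, …, n_r)`: the sum of `1 / (a₁ ^ n₁ ⋯ a_r ^ n_r)` over the
monic `a₁, …, a_r` with `d = deg a₁ > ⋯ > deg a_r`. -/
def powerSum (F : Type*) [Field F] [Finite F] [DecidableEq (RatFunc F)] (d : ℕ)
    (s : List ℕ) : Kinf F :=
  ∑ a ∈ (finite_tuplesOfDeg F s.length d).toFinset, term F s a

/-- The multiple zeta value `ζ_A(n₁, …, n_r)`. -/
def zeta (F : Type*) [Field F] [DecidableEq (RatFunc F)] (s : List ℕ) : Kinf F :=
  ∑' a : tuples F s.length, term F s a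

/-- The admissible tuples of weight `w`: all entries are positive and their sum is `w`. -/
def compositions (w : ℕ) : Set (List ℕ) :=
  {s | (∀ n ∈ s, 0 < n) ∧ s.sum = w}

/-- The `K`-vector space spanned by the multiple zeta values of weight `w`. -/
def mzvSpace (F : Type*) [Field F] [DecidableEq (RatFunc F)] (w : ℕ) :
    Submodule (RatFunc F) (Kinf F) :=
  Submodule.span (RatFunc F) (zeta F '' compositions w)

/-- The free `K`-vector space on the symbols `[s]`, `s` admissible of weight `w`. -/
def formalSpace (F : Type*) [Field F] (w : ℕ) : Submodule (RatFunc F) (List ℕ →₀ RatFunc F) :=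
  Finsupp.supported (RatFunc F) (RatFunc F) (compositions w)

/-- The `K`-linear map with `[s] ↦ ζ_A(s)`. -/
def zetaMap (F : Type*) [Field F] [DecidableEq (RatFunc F)] :
    (List ℕ →₀ RatFunc F) →ₗ[RatFunc F] Kinf F :=
  Finsupp.linearCombination (RatFunc F) (zeta F)

/-- The `K`-linear map with `[s] ↦ S_d(s)`. -/
def powerSumMap (F : Type*) [Field F] [Finite F] [DecidableEq (RatFunc F)] (d : ℕ) :
    (List ℕ →₀ RatFunc F) →ₗ[RatFunc F] Kinf F :=
  Finsupp.linearCombination (RatFunc F) (powerSum F d)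

/-- `D_i = (θ ^ q ^ i - θ ^ q ^ (i - 1)) ⋯ (θ ^ q ^ i - θ)` with `q = #F`. -/
def carlitzD (F : Type*) [Field F] [Fintype F] (i : ℕ) : RatFunc F :=
  ∏ j ∈ Finset.range i,
    (RatFunc.X ^ Fintype.card F ^ i - RatFunc.X ^ Fintype.card F ^ j)

/-- The list `q ^ m (q - 1), q ^ (m + 1) (q - 1), …, q ^ (m + n - 1) (q - 1)` of length `n`. -/
def block (q m n : ℕ) : List ℕ :=
  (List.range n).map fun i => q ^ (m + i) * (q - 1)

/-- The tuple `(q ^ (k - j), q ^ (k - j) (q - 1), …, q ^ (k - 1) (q - 1))`, for `1 ≤ j ≤ k`. -/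
def xiTuple (q k j : ℕ) : List ℕ :=
  q ^ (k - j) :: block q (k - j) j

/-- The coefficient `(-1) ^ (k + j) D_j ^ (q ^ (k - j)) / D_k`. -/
def xiCoeff (F : Type*) [Field F] [Fintype F] (k j : ℕ) : RatFunc F :=
  (-1) ^ (k + j) * carlitzD F j ^ Fintype.card F ^ (k - j) / carlitzD F k

/-- `Ξ_k = (1 / D_k) ∑_{j = 1}^k (-1) ^ (k + j) D_j ^ (q ^ (k - j))
  ∑_{d ≥ 0} S_d(1) S_d(q ^ (k - j), q ^ (k - j) (q - 1), …, q ^ (k - 1) (q - 1))`. -/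
def xi (F : Type*) [Field F] [Fintype F] [DecidableEq (RatFunc F)] (k : ℕ) : Kinf F :=
  ∑ j ∈ Finset.Icc 1 k, xiCoeff F k j •
    ∑' d : ℕ, powerSum F d [1] * powerSum F d (xiTuple (Fintype.card F) k j)

end

end ThakurMZV

open Polynomial

namespace ThakurMZV

noncomputable section

/-! Write `S_{<d}` for sums over `d > deg a₁ > ⋯` (`pSumLT`) and `ℓ_d` for `carlitzL`. The relation
already holds for each `d`, before summation.

The product of `x - a` over monic `a` of degree `d` is `e_d(x) - D_d`, with `e_d` an `F`-linear
polynomial of linear coefficient `D_d / ℓ_d`. Its logarithmic derivative gives `S_d(n) = ℓ_d ^ (-n)`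
for `1 ≤ n ≤ q` (`pSum_eq`). An induction then evaluates `S_{<d}(q-1, …, q^(j-1)(q-1))` in closed
form (`pSumLT_add_block`), so that `S_d(1) S_{<d}(q-1, …, q^(j-1)(q-1))` is `(-1)^j / D_j` times
`S_{d-j}(1)^(q^j)`, or `0` if `d < j`.

Put `h(e) = S_e(1)^(q^k) = S_e(q^k)`. Up to the factor `(-1)^k / D_k`, `S_{<d}(1, q-1, …)` is the
sum of `h(e - k)` over `k ≤ e < d`, while `S_{<d}(q^k)` is the sum of all `h(e)`, `e < d`. They
differ by the top terms `h(d-1), …, h(d-k)`, and the `j`-th term of `Ξ_k` supplies `h(d-j)`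
(`pSumLT_relation`). Multiplying by `S_d(1)` and summing over `d` gives the relation.

The products in `Ξ_k` expand over the prime field by partial fractions in `a`, `b`, `a - b`
(`pSum_mul_pSum_mul_pSumLT_mem`). For non-triviality, multiply the coefficient of `[1, q^k]` by
`D_k` and set `θ = 0`: each `D_j` with `j ≥ 1` vanishes there, leaving `±1`
(`relation_coeff_ne_zero`). -/

theorem _root_.Valued.nonarchimedeanAddGroup {L Γ₀ : Type*} [Ring L]
    [LinearOrderedCommGroupWithZero Γ₀] [Valued L Γ₀] : NonarchimedeanAddGroup L where
  is_nonarchimedean U hU := by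
    obtain ⟨γ, hγ⟩ := Valued.mem_nhds_zero.1 hU
    exact ⟨⟨Valued.v.restrict.ltAddSubgroup γ, Valued.isOpen_ball _ γ.1⟩, hγ⟩

/-- In a complete nonarchimedean group a family is summable as soon as it tends to zero along the
cofinite filter. -/
theorem _root_.Valued.summable_of_finite_exp_le {L ι : Type*} [Ring L]
    [Valued L (WithZero (Multiplicative ℤ))] [CompleteSpace L] {f : ι → L}
    (hf : ∀ m : ℤ, {i | WithZero.exp m ≤ Valued.v (f i)}.Finite) : Summable f := by
  have : NonarchimedeanAddGroup L := Valued.nonarchimedeanAddGroup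
  refine NonarchimedeanAddGroup.summable_of_tendsto_cofinite_zero fun U hU => ?_
  obtain ⟨γ, hγ⟩ := Valued.mem_nhds_zero.1 hU
  rw [Filter.mem_map, Filter.mem_cofinite]
  obtain ⟨m, hm⟩ : ∃ m : ℤ, WithZero.exp m = MonoidWithZeroHom.ValueGroup₀.embedding γ.1 :=
    ⟨WithZero.log _, WithZero.exp_log (by simp)⟩
  refine (hf m).subset fun i hi => ?_
  by_contra h
  refine hi (hγ ?_)
  change Valued.v.restrict (f i) < γ.1
  rw [Valuation.restrict_lt_iff_lt_embedding, ← hm]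
  exact not_le.1 h

/-! ### Convergence in `K_∞` -/

section Topology

variable (F : Type*) [Field F] [DecidableEq (RatFunc F)]

theorem valued_algebraMap (x : RatFunc F) :
    Valued.v (algebraMap (RatFunc F) (Kinf F) x) = RatFunc.inftyValuation F x := by
  rw [RatFunc.valuedCompletionAtInfty.def]
  let _ := RatFunc.inftyValued F
  exact Valued.extensionValuation_apply_coe x

instance : CompleteSpace (Kinf F) := by
  let _ := (RatFunc.inftyValued F).toUniformSpace
  exact inferInstanceAs (CompleteSpace (UniformSpace.Completion (RatFunc F)))

variable {F}

theorem exp_sum {ι : Type*} (s : Finset ι) (f : ι → ℤ) :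
    WithZero.exp (∑ i ∈ s, f i) = ∏ i ∈ s, WithZero.exp (f i) := by
  classical
  induction s using Finset.induction_on with
  | empty => simp
  | insert a s ha ih => rw [Finset.sum_insert ha, Finset.prod_insert ha, WithZero.exp_add, ih]

theorem valuation_poly {p : F[X]} (hp : p ≠ 0) :
    RatFunc.inftyValuation F (algebraMap F[X] (RatFunc F) p) = WithZero.exp (p.natDegree : ℤ) := by
  rw [RatFunc.inftyValuation_apply]
  exact RatFunc.inftyValuation.polynomial F hp

theorem valued_term (s : List ℕ) (a : Fin s.length → F[X]) (ha : a ∈ tuples F s.length) :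
    Valued.v (term F s a) = WithZero.exp (-∑ i, ((s.get i : ℤ) * (a i).natDegree)) := by
  rw [term, valued_algebraMap, map_prod, ← Finset.sum_neg_distrib]
  rw [exp_sum]
  refine Finset.prod_congr rfl fun i _ => ?_
  rw [map_inv₀, map_pow, valuation_poly (ha.1 i).ne_zero, ← WithZero.exp_nsmul, WithZero.exp_neg]
  simp

theorem summable_term [Finite F] (s : List ℕ) (hs : ∀ n ∈ s, 0 < n) :
    Summable fun a : tuples F s.length => term F s a := by
  refine Valued.summable_of_finite_exp_le fun m => ?_
  have hfin : {p : F[X] | p.natDegree ≤ (-m).toNat}.Finite := by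
    have : Finite (degreeLT F ((-m).toNat + 1)) :=
      Finite.of_equiv _ (degreeLTEquiv F ((-m).toNat + 1)).toEquiv.symm
    refine (Set.toFinite (degreeLT F ((-m).toNat + 1) : Set F[X])).subset fun p hp => ?_
    exact mem_degreeLT.2 (lt_of_le_of_lt degree_le_natDegree
      (by exact_mod_cast Nat.lt_succ_of_le hp))
  refine ((Set.Finite.pi' fun _ : Fin s.length => hfin).preimage
    (f := fun a : tuples F s.length => a.1) Subtype.val_injective.injOn).subset fun a ha i => ?_
  have h1 : WithZero.exp m ≤ Valued.v (term F s a) := ha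
  have h3 := valued_term s a.1 a.2
  rw [h3, WithZero.exp_le_exp] at h1
  -- Positivity of the exponents lets the valuation bound every single degree, leaving finitely many
  -- tuples.
  have h2 : (1 : ℤ) * (a.1 i).natDegree ≤ ∑ i, ((s.get i : ℤ) * (a.1 i).natDegree) := by
    refine le_trans ?_ (Finset.single_le_sum (f := fun i => (s.get i : ℤ) * (a.1 i).natDegree)
      (fun j _ => by positivity) (Finset.mem_univ i))
    have := hs _ (s.get_mem i)
    gcongr
    exact_mod_cast this
  change (a.1 i).natDegree ≤ (-m).toNat
  omega

/-- Unconditional summability permits grouping the tuples by the degree of the leading entry. -/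
theorem hasSum_powerSum [Finite F] (s : List ℕ) (hs : ∀ n ∈ s, 0 < n) :
    HasSum (fun d => powerSum F d s) (zeta F s) := by
  have h := ((Equiv.sigmaFiberEquiv fun a : tuples F s.length => leadDeg a.1).hasSum_iff).2
    (summable_term (F := F) s hs).hasSum
  refine HasSum.sigma h fun d => ?_
  have h2 := Finset.hasSum (finite_tuplesOfDeg F s.length d).toFinset (term F s)
  let e' : {a : tuples F s.length // leadDeg a.1 = d} ≃
      (finite_tuplesOfDeg F s.length d).toFinset :=
    { toFun := fun a => ⟨a.1.1, (finite_tuplesOfDeg F s.length d).mem_toFinset.2 ⟨a.1.2, a.2⟩⟩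
      invFun := fun a => ⟨⟨a.1, ((finite_tuplesOfDeg F s.length d).mem_toFinset.1 a.2).1⟩,
        ((finite_tuplesOfDeg F s.length d).mem_toFinset.1 a.2).2⟩
      left_inv := fun a => rfl
      right_inv := fun a => rfl }
  have h3 := e'.hasSum_iff.2 h2
  rw [powerSum]
  exact h3

theorem hasSum_powerSumMap [Finite F] (L : List ℕ →₀ RatFunc F)
    (hL : ∀ s ∈ L.support, ∀ n ∈ s, 0 < n) :
    HasSum (fun d => powerSumMap F d L) (zetaMap F L) := by
  simp only [powerSumMap, zetaMap, Finsupp.linearCombination_apply, Finsupp.sum, Algebra.smul_def]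
  exact hasSum_sum fun s hs => (hasSum_powerSum s (hL s hs)).mul_left _

end Topology

/-! ### Power sums as recursively defined elements of `K` -/

section PowerSums

variable (F : Type*) [Field F]

/-- The monic polynomials of degree `d`. -/
def monics [Finite F] (d : ℕ) : Finset F[X] :=
  (show {p : F[X] | p.Monic ∧ p.natDegree = d}.Finite by
    have : Finite (degreeLT F (d + 1)) := Finite.of_equiv _ (degreeLTEquiv F (d + 1)).toEquiv.symm
    refine (Set.toFinite (degreeLT F (d + 1) : Set F[X])).subset fun p hp => ?_
    exact mem_degreeLT.2 (lt_of_le_of_lt degree_le_natDegree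
      (by exact_mod_cast Nat.lt_succ_of_le hp.2.le))).toFinset

variable {F}

@[simp]
theorem mem_monics [Finite F] {d : ℕ} {p : F[X]} : p ∈ monics F d ↔ p.Monic ∧ p.natDegree = d := by
  simp [monics]

variable (F)

/-- The power sum `S_d(n)` as an element of `K`. -/
def pSum [Finite F] (d n : ℕ) : RatFunc F :=
  ∑ a ∈ monics F d, (algebraMap F[X] (RatFunc F) a ^ n)⁻¹

/-- The sum of `1 / (a₁ ^ n₁ ⋯ a_r ^ n_r)` over the monic `a₁, …, a_r` with
`d > deg a₁ > ⋯ > deg a_r`. -/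
def pSumLT [Finite F] : ℕ → List ℕ → RatFunc F
  | _, [] => 1
  | d, n :: t => ∑ e ∈ Finset.range d, pSum F e n * pSumLT e t

/-- The tuples of monic polynomials with `d > deg a₁ > ⋯ > deg a_r`. -/
def tuplesLT (r d : ℕ) : Set (Fin r → F[X]) :=
  {a | a ∈ tuples F r ∧ ∀ i, (a i).natDegree < d}

theorem finite_tuplesLT [Finite F] (r d : ℕ) : (tuplesLT F r d).Finite := by
  cases r with
  | zero => exact Set.toFinite _
  | succ r =>
    refine (Set.Finite.biUnion (Finset.range d).finite_toSet
      fun e _ => finite_tuplesOfDeg F (r + 1) e).subset fun a ha => ?_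
    simp only [Set.mem_iUnion, Finset.coe_range, Set.mem_Iio]
    exact ⟨(a 0).natDegree, ha.2 0, ha.1, by simp [leadDeg]⟩

variable {F}

theorem cons_mem_tuples {r : ℕ} {a : F[X]} {b : Fin r → F[X]} :
    (Fin.cons a b : Fin (r + 1) → F[X]) ∈ tuples F (r + 1) ↔
      a.Monic ∧ b ∈ tuplesLT F r a.natDegree := by
  simp only [tuples, tuplesLT, Set.mem_ofPred_eq, Fin.forall_fin_succ, Fin.cons_zero, Fin.cons_succ]
  constructor
  · rintro ⟨⟨h1, h2⟩, h3⟩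
    exact ⟨h1, ⟨h2, fun i j hij => h3 (Fin.succ_lt_succ_iff.2 hij)⟩,
      fun i => by simpa using h3 (Fin.succ_pos i)⟩
  · rintro ⟨h1, ⟨h2, h3⟩, h4⟩
    refine ⟨⟨h1, h2⟩, fun i j => ?_⟩
    refine Fin.cases ?_ (fun j => ?_) j
    · exact fun h => absurd h (Fin.not_lt_zero i)
    · refine Fin.cases ?_ (fun i => ?_) i
      · simpa using h4 j
      · simpa using fun h => h3 h

variable [DecidableEq (RatFunc F)]

theorem term_cons (n : ℕ) (t : List ℕ) (a : F[X]) (b : Fin t.length → F[X]) :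
    term F (n :: t) (Fin.cons a b : Fin (t.length + 1) → F[X]) =
      algebraMap (RatFunc F) (Kinf F) ((algebraMap F[X] (RatFunc F) a ^ n)⁻¹) * term F t b := by
  rw [term, term, ← map_mul]
  congr 1
  exact Fin.prod_univ_succ (n := t.length) _

variable [Finite F]

theorem powerSum_cons_eq_mul_sum (d n : ℕ) (t : List ℕ) :
    powerSum F d (n :: t) = algebraMap (RatFunc F) (Kinf F) (pSum F d n) *
      ∑ b ∈ (finite_tuplesLT F t.length d).toFinset, term F t b := by
  rw [pSum, map_sum, Finset.sum_mul_sum, ← Finset.sum_product', powerSum]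
  symm
  refine Finset.sum_bij (fun x _ => (Fin.cons x.1 x.2 : Fin (t.length + 1) → F[X])) ?_ ?_ ?_ ?_
  · rintro ⟨a, b⟩ h
    simp only [Finset.mem_product, mem_monics, Set.Finite.mem_toFinset] at h ⊢
    refine ⟨cons_mem_tuples.2 ⟨h.1.1, by rw [h.1.2]; exact h.2⟩, ?_⟩
    simp [leadDeg, h.1.2]
  · rintro ⟨a, b⟩ _ ⟨a', b'⟩ _ h
    have := Fin.cons_injective2 h
    exact Prod.ext this.1 this.2
  · intro c hc
    simp only [Set.Finite.mem_toFinset, exists_prop, Prod.exists, Finset.mem_product,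
      mem_monics] at hc ⊢
    have h1 := hc.1
    have h2 : (c 0).natDegree = d := by simpa [leadDeg] using hc.2
    rw [← Fin.cons_self_tail c] at h1
    have h3 := cons_mem_tuples.1 h1
    exact ⟨c 0, Fin.tail c, ⟨⟨h3.1, h2⟩, h2 ▸ h3.2⟩, Fin.cons_self_tail c⟩
  · rintro ⟨a, b⟩ h
    exact (term_cons n t a b).symm

theorem sum_term_tuplesLT (d : ℕ) (t : List ℕ) :
    ∑ b ∈ (finite_tuplesLT F t.length d).toFinset, term F t b =
      algebraMap (RatFunc F) (Kinf F) (pSumLT F d t) := by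
  induction t generalizing d with
  | nil =>
    have : (finite_tuplesLT F ([] : List ℕ).length d).toFinset = {Fin.elim0} := by
      ext a
      simp only [Set.Finite.mem_toFinset, Finset.mem_singleton]
      refine ⟨fun _ => funext fun i => i.elim0, fun _ => ⟨⟨fun i => i.elim0, fun i => i.elim0⟩,
        fun i => i.elim0⟩⟩
    rw [this, Finset.sum_singleton]
    simp [term, pSumLT]
  | cons n t ih =>
    classical
    have h : (finite_tuplesLT F (n :: t).length d).toFinset =
        (Finset.range d).biUnion fun e => (finite_tuplesOfDeg F (n :: t).length e).toFinset := by
      ext a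
      simp only [Set.Finite.mem_toFinset, Finset.mem_biUnion, Finset.mem_range]
      constructor
      · rintro ⟨h1, h2⟩
        exact ⟨leadDeg a, by simpa [leadDeg] using h2 ⟨0, by simp⟩, h1, rfl⟩
      · rintro ⟨e, he, h1, h2⟩
        refine ⟨h1, fun i => lt_of_le_of_lt ?_ he⟩
        rw [← h2, leadDeg, dif_pos (by simp)]
        exact h1.2.antitone (Nat.zero_le _)
    rw [h, Finset.sum_biUnion, pSumLT, map_sum]
    · refine Finset.sum_congr rfl fun e _ => ?_
      rw [map_mul, ← ih, ← powerSum_cons_eq_mul_sum, powerSum]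
    · intro e _ e' _ hne
      refine Finset.disjoint_left.2 fun a ha ha' => hne ?_
      rw [Set.Finite.mem_toFinset] at ha ha'
      exact ha.2.symm.trans ha'.2

/-- Splitting off the leading entry moves all later computations from `K_∞` to `K`. -/
theorem powerSum_cons (d n : ℕ) (t : List ℕ) :
    powerSum F d (n :: t) = algebraMap (RatFunc F) (Kinf F) (pSum F d n * pSumLT F d t) := by
  rw [powerSum_cons_eq_mul_sum, sum_term_tuplesLT, map_mul]

theorem powerSum_singleton (d n : ℕ) :
    powerSum F d [n] = algebraMap (RatFunc F) (Kinf F) (pSum F d n) := by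
  rw [powerSum_cons, pSumLT, mul_one]

end PowerSums

/-! ### Carlitz's linear polynomials `e_d` -/

section Carlitz

variable (F : Type*) [Field F] [Fintype F] {R : Type*} [CommRing R] [Algebra F R]

local notation "q" => Fintype.card F

theorem sub_pow_card (x y : R) : (x - y) ^ q = x ^ q - y ^ q :=
  map_sub (FiniteField.frobeniusAlgHom F R) x y

theorem add_pow_card (x y : R) : (x + y) ^ q = x ^ q + y ^ q :=
  map_add (FiniteField.frobeniusAlgHom F R) x y

theorem sum_pow_card {ι : Type*} (s : Finset ι) (f : ι → R) :
    (∑ i ∈ s, f i) ^ q = ∑ i ∈ s, f i ^ q :=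
  map_sum (FiniteField.frobeniusAlgHom F R) f s

theorem sum_pow_card_pow {ι : Type*} (s : Finset ι) (f : ι → R) (m : ℕ) :
    (∑ i ∈ s, f i) ^ q ^ m = ∑ i ∈ s, f i ^ q ^ m := by
  induction m with
  | zero => simp
  | succ m ih => simp_rw [pow_succ, pow_mul, ih, sum_pow_card]

theorem sub_pow_card_pow (x y : R) (m : ℕ) : (x - y) ^ q ^ m = x ^ q ^ m - y ^ q ^ m := by
  induction m with
  | zero => simp
  | succ m ih => simp_rw [pow_succ, pow_mul, ih, sub_pow_card]

theorem neg_one_pow_card : (-1 : R) ^ q = -1 := by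
  simpa [zero_pow Fintype.card_ne_zero] using sub_pow_card F (0 : R) 1

theorem neg_one_pow_card_pow (m : ℕ) : (-1 : R) ^ q ^ m = -1 := by
  induction m with
  | zero => simp
  | succ m ih => rw [pow_succ, pow_mul, ih, neg_one_pow_card]

/-- The product `D_d` with an arbitrary element `t` in place of `θ`. -/
def carlitzDAt (t : R) (d : ℕ) : R :=
  ∏ j ∈ Finset.range d, (t ^ q ^ d - t ^ q ^ j)

theorem carlitzDAt_succ (t : R) (d : ℕ) :
    carlitzDAt F t (d + 1) = (t ^ q ^ (d + 1) - t) * carlitzDAt F t d ^ q := by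
  rw [carlitzDAt, Finset.prod_range_succ', carlitzDAt, ← Finset.prod_pow, mul_comm]
  simp only [sub_pow_card, ← pow_mul, ← pow_succ, pow_zero, pow_one]

/-- The `F`-linear map `x ↦ ∏ (x - a(t))`, the product over the polynomials of degree `< d`. -/
def carlitzE (t : R) : ℕ → R →ₗ[F] R
  | 0 => LinearMap.id
  | d + 1 => (FiniteField.frobeniusAlgHom F R).toLinearMap ∘ₗ carlitzE t d -
      LinearMap.mulLeft F (carlitzDAt F t d ^ (q - 1)) ∘ₗ carlitzE t d

theorem carlitzE_zero (t x : R) : carlitzE F t 0 x = x := rfl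

theorem carlitzE_succ (t x : R) (d : ℕ) : carlitzE F t (d + 1) x =
    carlitzE F t d x ^ q - carlitzDAt F t d ^ (q - 1) * carlitzE F t d x := rfl

theorem mul_pow_card_sub_one {S : Type*} [Monoid S] (x : S) : x ^ (q - 1) * x = x ^ q := by
  rw [← pow_succ, Nat.sub_add_cancel Fintype.card_pos]

/-- This commutation rule with multiplication by `t` is what makes `e_d(t^d) = D_d` an easy
induction. -/
theorem carlitzE_succ_mul (t x : R) (d : ℕ) : carlitzE F t (d + 1) (t * x) =
    t * carlitzE F t (d + 1) x + (t ^ q ^ (d + 1) - t) * carlitzE F t d x ^ q := by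
  induction d with
  | zero =>
    simp only [carlitzE_succ, carlitzE_zero, carlitzDAt, Finset.range_zero, Finset.prod_empty,
      mul_pow]
    ring
  | succ d ih =>
    rw [carlitzE_succ, ih, carlitzE_succ F t x (d + 1), add_pow_card, mul_pow, mul_pow,
      sub_pow_card]
    have h1 : carlitzE F t (d + 1) x ^ q = (carlitzE F t d x ^ q) ^ q -
        (carlitzDAt F t d ^ q) ^ (q - 1) * carlitzE F t d x ^ q := by
      rw [carlitzE_succ, sub_pow_card, mul_pow, pow_right_comm (carlitzDAt F t d)]
    have h2 : (t ^ q ^ (d + 1)) ^ q = t ^ q ^ (d + 1 + 1) := by rw [← pow_mul, ← pow_succ]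
    have h3 := mul_pow_card_sub_one F (t ^ q ^ (d + 1) - t)
    rw [sub_pow_card, h2] at h3
    rw [carlitzDAt_succ F t d, mul_pow, h2]
    -- The recursion is used backwards to eliminate the double Frobenius power.
    have h4 : (carlitzE F t d x ^ q) ^ q = carlitzE F t (d + 1) x ^ q +
        (carlitzDAt F t d ^ q) ^ (q - 1) * carlitzE F t d x ^ q := by rw [h1]; ring
    rw [h4]
    linear_combination (-(carlitzDAt F t d ^ q) ^ (q - 1) * carlitzE F t d x ^ q) * h3

theorem carlitzE_pow_self (t : R) (d : ℕ) : carlitzE F t d (t ^ d) = carlitzDAt F t d := by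
  induction d with
  | zero => simp [carlitzE_zero, carlitzDAt]
  | succ d ih =>
    rw [pow_succ', carlitzE_succ_mul, carlitzE_succ, ih, mul_pow_card_sub_one, sub_self, mul_zero,
      zero_add, carlitzDAt_succ]

/-- Homogenization of `∏ (X - c) = X ^ q - X`. -/
theorem prod_sub_algebraMap_mul_of_field {L : Type*} [Field L] [Algebra F L] (x y : L) :
    ∏ c : F, (x - algebraMap F L c * y) = x ^ q - y ^ (q - 1) * x := by
  have hq : 1 < q := Fintype.one_lt_card
  have h : ∏ c : F, (X - C c) = (X ^ q - X : F[X]) := by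
    have h1 : (X ^ q - X : F[X]).Monic :=
      monic_X_pow_sub (by rw [degree_X]; exact_mod_cast hq)
    have h2 := prod_multiset_X_sub_C_of_monic_of_roots_card_eq h1 (by
      rw [FiniteField.roots_X_pow_card_sub_X, FiniteField.X_pow_card_sub_X_natDegree_eq F hq]; rfl)
    rwa [FiniteField.roots_X_pow_card_sub_X] at h2
  rcases eq_or_ne y 0 with rfl | hy
  · simp [zero_pow (Nat.sub_ne_zero_of_lt hq)]
  · have h3 := congrArg (aeval (x / y)) h
    simp only [map_prod, map_sub, aeval_X, aeval_C, map_pow] at h3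
    have h4 : ∀ c : F, x - algebraMap F L c * y = y * (x / y - algebraMap F L c) := fun c => by
      field_simp
    simp_rw [h4, Finset.prod_mul_distrib, h3, Finset.prod_const, Finset.card_univ]
    rw [← mul_pow_card_sub_one F y, div_pow, ← mul_pow_card_sub_one F y]
    field_simp

theorem prod_sub_algebraMap_mul [IsDomain R] (x y : R) :
    ∏ c : F, (x - algebraMap F R c * y) = x ^ q - y ^ (q - 1) * x := by
  apply IsFractionRing.injective R (FractionRing R)
  have := prod_sub_algebraMap_mul_of_field F (algebraMap R (FractionRing R) x)
    (algebraMap R (FractionRing R) y)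
  simpa [map_prod, IsScalarTower.algebraMap_apply F R (FractionRing R)] using this

/-- The polynomials of degree `< d`. -/
def polysLT (d : ℕ) : Finset F[X] :=
  (show {p : F[X] | p.degree < d}.Finite by
    have : Finite (degreeLT F d) := Finite.of_equiv _ (degreeLTEquiv F d).toEquiv.symm
    exact (Set.toFinite (degreeLT F d : Set F[X])).subset fun p hp => mem_degreeLT.2 hp).toFinset

variable {F}

@[simp]
theorem mem_polysLT {d : ℕ} {p : F[X]} : p ∈ polysLT F d ↔ p.degree < d := by
  simp [polysLT]

variable (F)

theorem prod_polysLT_succ {M : Type*} [CommMonoid M] (d : ℕ) (f : F[X] → M) :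
    ∏ p ∈ polysLT F (d + 1), f p = ∏ c : F, ∏ p ∈ polysLT F d, f (C c * X ^ d + p) := by
  rw [← Finset.prod_product']
  refine (Finset.prod_bij' (fun x _ => C x.1 * X ^ d + x.2)
    (fun p _ => (p.coeff d, p - C (p.coeff d) * X ^ d)) ?_ ?_ ?_ ?_ ?_).symm
  · rintro ⟨c, p⟩ h
    simp only [Finset.mem_product, Finset.mem_univ, true_and, mem_polysLT] at h ⊢
    refine lt_of_le_of_lt (degree_add_le _ _) (max_lt ?_
      (h.trans (by exact_mod_cast d.lt_succ_self)))
    exact lt_of_le_of_lt (degree_C_mul_X_pow_le d c) (by exact_mod_cast d.lt_succ_self)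
  · intro p h
    simp only [Finset.mem_product, Finset.mem_univ, true_and, mem_polysLT] at h ⊢
    rw [degree_lt_iff_coeff_zero] at h ⊢
    intro m hm
    rcases hm.eq_or_lt with rfl | hm
    · simp
    · simp [h m hm, coeff_X_pow, hm.ne']
  · rintro ⟨c, p⟩ h
    simp only [Finset.mem_product, Finset.mem_univ, true_and, mem_polysLT] at h
    simp [coeff_eq_zero_of_degree_lt h]
  · intro p _
    simp
  · intro x _
    rfl

theorem prod_monics {M : Type*} [CommMonoid M] (d : ℕ) (f : F[X] → M) :
    ∏ p ∈ monics F d, f p = ∏ p ∈ polysLT F d, f (X ^ d + p) := by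
  refine (Finset.prod_bij' (fun p _ => X ^ d + p) (fun p _ => p - X ^ d) ?_ ?_ ?_ ?_ ?_).symm
  · intro p h
    rw [mem_polysLT] at h
    rw [mem_monics]
    exact ⟨monic_X_pow_add h, natDegree_eq_of_degree_eq_some
      (by rw [degree_add_eq_left_of_degree_lt (by simpa using h), degree_X_pow])⟩
  · intro p h
    rw [mem_monics] at h
    rw [mem_polysLT]
    have h1 : p.degree = d := by rw [degree_eq_natDegree h.1.ne_zero, h.2]
    rw [← h1]
    exact degree_sub_lt_left (by rw [h1, degree_X_pow]) h.1.ne_zero (by simp [h.1.leadingCoeff])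
  · intro p _
    simp
  · intro p _
    simp
  · intro p _
    rfl

theorem prod_polysLT_sub_aeval [IsDomain R] (t x : R) (d : ℕ) :
    ∏ p ∈ polysLT F d, (x - aeval t p) = carlitzE F t d x := by
  induction d generalizing x with
  | zero =>
    have : polysLT F 0 = {0} := by
      ext p
      simp [Nat.WithBot.lt_zero_iff]
    simp [this, carlitzE_zero]
  | succ d ih =>
    rw [prod_polysLT_succ, carlitzE_succ, ← prod_sub_algebraMap_mul]
    refine Finset.prod_congr rfl fun c _ => ?_
    -- Since `D_d = e_d(t^d)`, linearity turns `e_d(x) - c D_d` into `e_d(x - c t^d)`, the product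
    -- over polynomials with `t^d`-coefficient `c`.
    rw [← carlitzE_pow_self, ← Algebra.smul_def, ← map_smul, ← map_sub, ← ih]
    refine Finset.prod_congr rfl fun p _ => ?_
    simp [Algebra.smul_def, sub_sub]

theorem prod_monics_sub_aeval [IsDomain R] (t x : R) (d : ℕ) :
    ∏ p ∈ monics F d, (x - aeval t p) = carlitzE F t d x - carlitzDAt F t d := by
  rw [prod_monics, ← carlitzE_pow_self, ← map_sub, ← prod_polysLT_sub_aeval]
  simp [sub_sub]

end Carlitz

/-! ### Power sums from a logarithmic derivative -/

section LogDeriv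

/-- Power sums of the inverses of the roots of `α + c X + O(X ^ q)`, when the derivative is the
constant `c`. -/
theorem sum_inv_pow_of_prod_eq {L ι : Type*} [Field L] (s : Finset ι) (x : ι → L)
    (hx : ∀ i ∈ s, x i ≠ 0) {α c : L} {Q : L[X]} {q : ℕ} (hα : α ≠ 0)
    (h : ∏ i ∈ s, (X - C (x i)) = C α + C c * X + X ^ q * Q)
    (hd : derivative (∏ i ∈ s, (X - C (x i))) = C c) {n : ℕ} (hn : n < q) :
    ∑ i ∈ s, (x i ^ (n + 1))⁻¹ = (-c / α) ^ (n + 1) := by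
  classical
  set G : PowerSeries L := PowerSeries.mk fun n => ∑ i ∈ s, (x i ^ (n + 1))⁻¹ with hG
  have h1 : ∀ i ∈ s, (PowerSeries.mk fun n => (x i ^ (n + 1))⁻¹) *
      ((X - C (x i) : L[X]) : PowerSeries L) = -1 := fun i hi => by
    ext m
    rw [Polynomial.coe_sub, Polynomial.coe_X, Polynomial.coe_C, mul_sub, map_sub,
      PowerSeries.coeff_mul_C]
    cases m with
    | zero => simp [hx i hi]
    | succ m =>
      rw [PowerSeries.coeff_succ_mul_X, PowerSeries.coeff_mk, PowerSeries.coeff_mk, map_neg,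
        PowerSeries.coeff_one, if_neg m.succ_ne_zero]
      have := hx i hi
      field_simp
      ring
  -- `G` is minus the logarithmic derivative of the product, by the geometric series for `1 / (X - x
  -- i)`.
  have h2 : G * ((∏ i ∈ s, (X - C (x i)) : L[X]) : PowerSeries L) = -PowerSeries.C c := by
    have h3 : G = ∑ i ∈ s, PowerSeries.mk fun n => (x i ^ (n + 1))⁻¹ := by
      ext m
      simp [hG]
    have h4 : ∀ f : ι → L[X], ((∑ i ∈ s, f i : L[X]) : PowerSeries L) =
        ∑ i ∈ s, (f i : PowerSeries L) :=
      fun f => map_sum (Polynomial.coeToPowerSeries.ringHom (R := L)) f s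
    rw [← Polynomial.coe_C, ← hd, derivative_prod_finset, h3, Finset.sum_mul, h4,
      ← Finset.sum_neg_distrib]
    refine Finset.sum_congr rfl fun i hi => ?_
    rw [← Finset.mul_prod_erase s _ hi, Polynomial.coe_mul, ← mul_assoc, h1 i hi]
    simp
  -- Modulo `X ^ q` only `α + c X` matters, so the coefficients of `G` form a geometric progression
  -- of ratio `-c / α`.
  have h4 : ∀ m < q, (PowerSeries.coeff m) (G * (PowerSeries.C α + PowerSeries.C c * PowerSeries.X))
      = (PowerSeries.coeff m) (-PowerSeries.C c) := fun m hm => by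
    rw [← h2, h, Polynomial.coe_add _ (X ^ q * Q), mul_add G _ ((X ^ q * Q : L[X]) : PowerSeries L),
      map_add]
    have : (PowerSeries.coeff m) (G * ((X ^ q * Q : L[X]) : PowerSeries L)) = 0 := by
      rw [Polynomial.coe_mul, Polynomial.coe_pow, Polynomial.coe_X, mul_left_comm]
      rw [PowerSeries.coeff_X_pow_mul', if_neg hm.not_ge]
    rw [this, add_zero]
    simp
  change (∑ i ∈ s, (x i ^ (n + 1))⁻¹) = _
  have h5 : ∀ m, ∑ i ∈ s, (x i ^ (m + 1))⁻¹ = PowerSeries.coeff m G := fun m => by simp [hG]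
  rw [h5]
  induction n with
  | zero =>
    have := h4 0 hn
    simp only [mul_add, map_add, PowerSeries.coeff_mul_C, ← mul_assoc,
      PowerSeries.coeff_zero_mul_X, add_zero, map_neg, PowerSeries.coeff_zero_C] at this
    rw [zero_add, pow_one, eq_div_iff hα, this]
  | succ n ih =>
    have := h4 (n + 1) hn
    simp only [mul_add, map_add, PowerSeries.coeff_mul_C, ← mul_assoc,
      PowerSeries.coeff_succ_mul_X, map_neg, PowerSeries.coeff_succ_C] at this
    rw [ih (by omega)] at this
    rw [pow_succ _ (n + 1), mul_div_assoc', eq_div_iff hα]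
    linear_combination this

end LogDeriv

/-! ### Values `S_d(n)` for `1 ≤ n ≤ q` -/

section Values

theorem X_pow_sub_X_pow_ne_zero (F : Type*) [Field F] {m n : ℕ} (h : m ≠ n) :
    (RatFunc.X ^ m - RatFunc.X ^ n : RatFunc F) ≠ 0 := by
  rw [sub_ne_zero]
  intro h1
  apply h
  have h2 : algebraMap F[X] (RatFunc F) (X ^ m) = algebraMap F[X] (RatFunc F) (X ^ n) := by
    simpa using h1
  simpa using congrArg natDegree (RatFunc.algebraMap_injective F h2)

theorem algebraMap_eq_aeval_X {F : Type*} [Field F] (p : F[X]) :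
    algebraMap F[X] (RatFunc F) p = aeval (RatFunc.X : RatFunc F) p := by
  rw [← RatFunc.algebraMap_X, aeval_algebraMap_apply, aeval_X_left_apply]

variable (F : Type*) [Field F] [Fintype F]

local notation "q" => Fintype.card F

/-- `ℓ_d = (θ - θ ^ q) ⋯ (θ - θ ^ q ^ d)`. -/
def carlitzL (d : ℕ) : RatFunc F :=
  ∏ i ∈ Finset.range d, (RatFunc.X - RatFunc.X ^ q ^ (i + 1))

theorem carlitzD_ne_zero (d : ℕ) : carlitzD F d ≠ 0 :=
  Finset.prod_ne_zero_iff.2 fun _ hj => X_pow_sub_X_pow_ne_zero F fun h =>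
    (Finset.mem_range.1 hj).ne' (Nat.pow_right_injective Fintype.one_lt_card h)

theorem carlitzL_ne_zero (d : ℕ) : carlitzL F d ≠ 0 :=
  Finset.prod_ne_zero_iff.2 fun j _ => by
    have := X_pow_sub_X_pow_ne_zero F (m := 1) (n := q ^ (j + 1))
      (Nat.one_lt_pow j.succ_ne_zero Fintype.one_lt_card).ne
    simpa using this

theorem carlitzD_succ (d : ℕ) : carlitzD F (d + 1) =
    (RatFunc.X ^ q ^ (d + 1) - RatFunc.X) * carlitzD F d ^ q := carlitzDAt_succ F _ d

theorem carlitzL_succ (d : ℕ) : carlitzL F (d + 1) =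
    carlitzL F d * (RatFunc.X - RatFunc.X ^ q ^ (d + 1)) := Finset.prod_range_succ _ _

theorem carlitzDAt_C (d : ℕ) :
    carlitzDAt F (C RatFunc.X : (RatFunc F)[X]) d = C (carlitzD F d) := by
  simp [carlitzDAt, carlitzD]

theorem exists_carlitzE_eq (d : ℕ) : ∃ Q : (RatFunc F)[X],
    carlitzE F (C RatFunc.X) d X = C (carlitzD F d / carlitzL F d) * X + X ^ q * Q := by
  induction d with
  | zero => exact ⟨0, by simp [carlitzE_zero, carlitzD, carlitzL]⟩
  | succ d ih =>
    obtain ⟨Q, hQ⟩ := ih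
    have hD := mul_pow_card_sub_one F (carlitzD F d)
    have hc : -(carlitzD F d ^ (q - 1) * (carlitzD F d / carlitzL F d)) =
        carlitzD F (d + 1) / carlitzL F (d + 1) := by
      have h1 := carlitzL_ne_zero F d
      have h2 := carlitzL_ne_zero F (d + 1)
      rw [mul_div_assoc', hD, carlitzD_succ, eq_div_iff h2, carlitzL_succ]
      field_simp
      ring
    -- The `q`-th power of `e_d` is divisible by `X ^ q`, so only `-D_d ^ (q - 1) e_d` contributes
    -- to the linear coefficient.
    refine ⟨C (carlitzD F d / carlitzL F d) ^ q + X ^ (q * (q - 1)) * Q ^ q -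
      C (carlitzD F d ^ (q - 1)) * Q, ?_⟩
    rw [carlitzE_succ, carlitzDAt_C, hQ, add_pow_card, mul_pow, mul_pow, ← hc, ← pow_mul,
      ← C_pow]
    have h3 : (X : (RatFunc F)[X]) ^ (q * q) = X ^ q * X ^ (q * (q - 1)) := by
      rw [← pow_add]
      congr 1
      have := Nat.sub_add_cancel (Fintype.card_pos (α := F))
      nlinarith
    rw [h3]
    simp only [map_neg, map_mul, map_pow]
    ring

theorem derivative_carlitzE (d : ℕ) :
    derivative (carlitzE F (C (RatFunc.X : RatFunc F)) d X) =
      C (carlitzD F d / carlitzL F d) := by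
  have hq : (q : (RatFunc F)[X]) = 0 := by
    have : ((q : F) : F) = 0 := FiniteField.cast_card_eq_zero F
    rw [← map_natCast (algebraMap F (RatFunc F)[X]), this, map_zero]
  obtain ⟨Q, hQ⟩ := exists_carlitzE_eq F d
  have h : ∀ d, ∃ c : RatFunc F, derivative (carlitzE F (C (RatFunc.X : RatFunc F)) d X) = C c := by
    intro d
    induction d with
    | zero => exact ⟨1, by simp [carlitzE_zero]⟩
    | succ d ih =>
      obtain ⟨c, hc⟩ := ih
      refine ⟨-(carlitzD F d ^ (q - 1) * c), ?_⟩
      rw [carlitzE_succ, carlitzDAt_C, ← C_pow, derivative_sub, derivative_pow, derivative_C_mul,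
        hc]
      simp [hq]
  obtain ⟨c, hc⟩ := h d
  rw [hc]
  -- The derivative is constant in characteristic `p`; its value is the linear coefficient, to which
  -- `X ^ q * Q` contributes nothing as `q ≥ 2`.
  have h1 := congrArg (fun p => coeff p 0) hc
  have hq' : q ≠ 1 := Fintype.one_lt_card.ne'
  simp only [hQ, coeff_derivative, coeff_add, coeff_C_mul, coeff_X_pow_mul', coeff_C_zero] at h1
  rw [if_neg (by have := Fintype.one_lt_card (α := F); omega)] at h1
  simp at h1
  rw [h1]

theorem pSum_eq {d n : ℕ} (hn : n < q) : pSum F d (n + 1) = (carlitzL F d)⁻¹ ^ (n + 1) := by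
  obtain ⟨Q, hQ⟩ := exists_carlitzE_eq F d
  have h1 : ∏ a ∈ monics F d, (X - C (algebraMap F[X] (RatFunc F) a)) =
      carlitzE F (C (RatFunc.X : RatFunc F)) d X - C (carlitzD F d) := by
    rw [← carlitzDAt_C, ← prod_monics_sub_aeval]
    refine Finset.prod_congr rfl fun a _ => ?_
    rw [algebraMap_eq_aeval_X, ← Polynomial.algebraMap_eq, aeval_algebraMap_apply]
  have h2 := sum_inv_pow_of_prod_eq (monics F d) (fun a => algebraMap F[X] (RatFunc F) a)
    (fun a ha => RatFunc.algebraMap_ne_zero (mem_monics.1 ha).1.ne_zero)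
    (neg_ne_zero.2 (carlitzD_ne_zero F d)) (c := carlitzD F d / carlitzL F d) (Q := Q)
    (by rw [h1, hQ, map_neg]; ring)
    (by rw [h1, derivative_sub, derivative_carlitzE, derivative_C, sub_zero]) hn
  rw [pSum, h2]
  congr 1
  have := carlitzD_ne_zero F d
  field_simp

theorem pSum_one (d : ℕ) : pSum F d 1 = (carlitzL F d)⁻¹ := by
  simpa using pSum_eq F (d := d) (n := 0) Fintype.card_pos

theorem pSum_card_sub_one (d : ℕ) : pSum F d (q - 1) = (carlitzL F d)⁻¹ ^ (q - 1) := by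
  have h := Fintype.one_lt_card (α := F)
  have := pSum_eq F (d := d) (n := q - 2) (by omega)
  rwa [show q - 2 + 1 = q - 1 by omega] at this

theorem pSum_mul_card (d n : ℕ) : pSum F d (q * n) = pSum F d n ^ q := by
  rw [pSum, pSum, sum_pow_card]
  exact Finset.sum_congr rfl fun a _ => by rw [inv_pow, mul_comm, pow_mul]

end Values

/-! ### Closed form for the blocks and the relation for fixed `d` -/

section Relation

theorem map_mul_block (q m n j : ℕ) : (block q m j).map (q ^ n * ·) = block q (n + m) j := by
  simp only [block, List.map_map]
  refine List.map_congr_left fun i _ => ?_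
  simp only [Function.comp]
  ring

theorem block_succ (q m j : ℕ) : block q m (j + 1) = q ^ m * (q - 1) :: block q (m + 1) j := by
  simp only [block, List.range_succ_eq_map, List.map_cons, List.map_map, add_zero]
  congr 1
  refine List.map_congr_left fun i _ => ?_
  simp only [Function.comp]
  rw [Nat.succ_eq_add_one, add_comm i 1, add_assoc]

variable (F : Type*) [Field F] [Fintype F]

local notation "q" => Fintype.card F

theorem pSum_mul_card_pow (d n m : ℕ) : pSum F d (q ^ m * n) = pSum F d n ^ q ^ m := by
  induction m with
  | zero => simp
  | succ m ih => rw [pow_succ', mul_assoc, pSum_mul_card, ih, ← pow_mul, ← pow_succ, pow_succ']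

theorem pSumLT_map_mul (d m : ℕ) (t : List ℕ) :
    pSumLT F d (t.map (q ^ m * ·)) = pSumLT F d t ^ q ^ m := by
  induction t generalizing d with
  | nil => simp [pSumLT]
  | cons n t ih =>
    simp only [List.map_cons, pSumLT, sum_pow_card_pow, pSum_mul_card_pow, ih, mul_pow]

theorem pSumLT_cons_succ (d n : ℕ) (t : List ℕ) :
    pSumLT F (d + 1) (n :: t) = pSumLT F d (n :: t) + pSum F d n * pSumLT F d t := by
  rw [pSumLT, Finset.sum_range_succ, pSumLT]

theorem pSumLT_block_succ_succ (d j : ℕ) : pSumLT F (d + 1) (block q 0 (j + 1)) =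
    pSumLT F d (block q 0 (j + 1)) + pSum F d (q - 1) * pSumLT F d (block q 0 j) ^ q := by
  rw [block_succ, pow_zero, one_mul, pSumLT_cons_succ, ← map_mul_block q 0 1, pSumLT_map_mul,
    pow_one]

theorem pSumLT_zero_block_succ (j : ℕ) : pSumLT F 0 (block q 0 (j + 1)) = 0 := by
  rw [block_succ, pSumLT, Finset.range_zero, Finset.sum_empty]

/-- There are no `j` strictly decreasing degrees below `d < j`. -/
theorem pSumLT_block_of_lt {d j : ℕ} (h : d < j) : pSumLT F d (block q 0 j) = 0 := by
  induction d generalizing j with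
  | zero =>
    obtain ⟨j, rfl⟩ := Nat.exists_eq_succ_of_ne_zero h.ne'
    exact pSumLT_zero_block_succ F j
  | succ d ih =>
    obtain ⟨j, rfl⟩ := Nat.exists_eq_succ_of_ne_zero (Nat.ne_zero_of_lt h)
    rw [Nat.succ_eq_add_one, pSumLT_block_succ_succ, ih (by omega), ih (by omega),
      zero_pow Fintype.card_ne_zero, mul_zero, add_zero]

theorem carlitzL_succ_pow (m j : ℕ) : carlitzL F (m + 1) ^ q ^ j =
    carlitzL F m ^ q ^ j * (RatFunc.X ^ q ^ j - RatFunc.X ^ q ^ (m + 1 + j)) := by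
  rw [carlitzL_succ, mul_pow, sub_pow_card_pow, ← pow_mul, ← pow_add]

theorem pSumLT_add_block (j m : ℕ) : pSumLT F (j + m) (block q 0 j) =
    (-1) ^ j * carlitzL F (j + m) / (carlitzD F j * carlitzL F m ^ q ^ j) := by
  induction j generalizing m with
  | zero =>
    have := carlitzL_ne_zero F m
    simp [block, pSumLT, carlitzD, this]
  | succ j ih =>
    -- The increment when the degree bound grows by one, known from the case `j`.
    have key : ∀ m, pSum F (j + m) (q - 1) * pSumLT F (j + m) (block q 0 j) ^ q =
        (-1) ^ j * carlitzL F (j + m) / (carlitzD F j ^ q * carlitzL F m ^ q ^ (j + 1)) := by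
      intro m
      have h1 := carlitzL_ne_zero F m
      have h2 := carlitzD_ne_zero F j
      have h3 := carlitzL_ne_zero F (j + m)
      rw [ih, pSum_card_sub_one, inv_pow, div_pow, mul_pow, mul_pow, ← pow_mul, ← pow_mul,
        ← pow_succ, mul_comm j, pow_mul, neg_one_pow_card, ← mul_pow_card_sub_one F (carlitzL F (j + m))]
      field_simp
    have hX : (RatFunc.X ^ q ^ (j + 1) - RatFunc.X : RatFunc F) ≠ 0 := by
      simpa using X_pow_sub_X_pow_ne_zero F (m := q ^ (j + 1)) (n := 1)
        (Nat.one_lt_pow j.succ_ne_zero Fintype.one_lt_card).ne'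
    have h2 := carlitzD_ne_zero F j
    induction m with
    | zero =>
      have := key 0
      rw [add_zero, pSumLT_block_succ_succ, pSumLT_block_of_lt F j.lt_succ_self,
        zero_add]
      rw [add_zero] at this
      rw [this, carlitzD_succ, carlitzL_succ]
      simp only [carlitzL, Finset.range_zero, Finset.prod_empty, one_pow, mul_one]
      field_simp
      ring
    | succ m ihm =>
      have h1 := carlitzL_ne_zero F m
      have h3 := carlitzL_ne_zero F (m + 1)
      have h4 := carlitzL_succ_pow F m (j + 1)
      have h5 : carlitzL F (m + 1) ^ q ^ (j + 1) ≠ 0 := pow_ne_zero _ h3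
      rw [h4] at h5
      have h6 := right_ne_zero_of_mul h5
      -- After clearing denominators, with `N = m + j + 2`, this is `(θ^(q^(j+1)) - θ^(q^N)) -
      -- (θ^(q^(j+1)) - θ) = θ - θ^(q^N)`.
      rw [← add_assoc, pSumLT_block_succ_succ, ihm, show j + 1 + m = j + (m + 1) by ring, key,
        carlitzL_succ F (j + (m + 1)), h4, carlitzD_succ,
        show j + (m + 1) + 1 = m + 1 + (j + 1) by ring]
      field_simp
      ring

theorem pSum_one_mul_pSumLT_block (d j : ℕ) : pSum F d 1 * pSumLT F d (block q 0 j) =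
    if j ≤ d then (-1) ^ j / carlitzD F j * pSum F (d - j) 1 ^ q ^ j else 0 := by
  split_ifs with h
  · obtain ⟨m, rfl⟩ := Nat.exists_eq_add_of_le h
    have h1 := carlitzL_ne_zero F m
    have h2 := carlitzD_ne_zero F j
    have h3 := carlitzL_ne_zero F (j + m)
    rw [pSumLT_add_block, Nat.add_sub_cancel_left, pSum_one, pSum_one, inv_pow]
    field_simp
  · rw [pSumLT_block_of_lt F (not_le.1 h), mul_zero]

/-- The shifted sum lacks exactly the last `k` terms; the conditions truncate both sums correctly
when `d < k`. -/
theorem sum_shift_add_sum_Icc {M : Type*} [AddCommGroup M] (h : ℕ → M) (k d : ℕ) :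
    (∑ e ∈ Finset.range d, if k ≤ e then h (e - k) else 0) +
      ∑ j ∈ Finset.Icc 1 k, (if j ≤ d then h (d - j) else 0) = ∑ e ∈ Finset.range d, h e := by
  induction k with
  | zero => simp
  | succ k ih =>
    rw [← ih, Finset.sum_Icc_succ_top (by omega), add_comm (∑ j ∈ Finset.Icc 1 k, _), ← add_assoc]
    congr 1
    rw [← Finset.sum_range_succ (fun e => if k + 1 ≤ e then h (e - (k + 1)) else 0),
      Finset.sum_range_succ']
    simp

theorem pSumLT_relation (d k : ℕ) :
    pSumLT F d (1 :: block q 0 k) + (-1) ^ (k + 1) / carlitzD F k * pSumLT F d [q ^ k] +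
      ∑ j ∈ Finset.Icc 1 k, xiCoeff F k j *
        (pSum F d 1 * pSumLT F d (block q 0 j)) ^ q ^ (k - j) = 0 := by
  have hk := carlitzD_ne_zero F k
  set h : ℕ → RatFunc F := fun e => pSum F e 1 ^ q ^ k with hh
  have h1 : pSumLT F d (1 :: block q 0 k) =
      (-1) ^ k / carlitzD F k * ∑ e ∈ Finset.range d, if k ≤ e then h (e - k) else 0 := by
    rw [pSumLT, Finset.mul_sum]
    refine Finset.sum_congr rfl fun e _ => ?_
    rw [pSum_one_mul_pSumLT_block, mul_ite, mul_zero]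
  have h2 : pSumLT F d [q ^ k] = ∑ e ∈ Finset.range d, h e := by
    simp only [pSumLT, mul_one, hh]
    exact Finset.sum_congr rfl fun e _ => by simpa using pSum_mul_card_pow F e 1 k
  have h3 : ∑ j ∈ Finset.Icc 1 k, xiCoeff F k j *
        (pSum F d 1 * pSumLT F d (block q 0 j)) ^ q ^ (k - j) =
      (-1) ^ k / carlitzD F k * ∑ j ∈ Finset.Icc 1 k, if j ≤ d then h (d - j) else 0 := by
    rw [Finset.mul_sum]
    refine Finset.sum_congr rfl fun j hj => ?_
    rw [pSum_one_mul_pSumLT_block]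
    split_ifs with hjd
    · have hD := carlitzD_ne_zero F j
      have hs : ((-1 : RatFunc F) ^ j) ^ q ^ (k - j) = (-1) ^ j := by
        rw [← pow_mul, mul_comm, pow_mul, neg_one_pow_card_pow]
      have hjk : q ^ j * q ^ (k - j) = q ^ k := by
        rw [← pow_add, Nat.add_sub_cancel' (Finset.mem_Icc.1 hj).2]
      have hs2 : (-1 : RatFunc F) ^ j * (-1) ^ j = 1 := by rw [← mul_pow]; simp
      rw [mul_pow, div_pow, hs, ← pow_mul, hjk, xiCoeff, pow_add]
      field_simp
      linear_combination h (d - j) * hs2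
    · rw [zero_pow (pow_ne_zero _ Fintype.card_ne_zero), mul_zero, mul_zero]
  rw [h1, h2, h3, ← sum_shift_add_sum_Icc h k d]
  ring

end Relation

/-! ### Expanding products of power sums over the prime field -/

section Expansion

variable (F : Type*) [Field F] [Fintype F]

local notation "q" => Fintype.card F

theorem sum_polysLT_succ {M : Type*} [AddCommMonoid M] (d : ℕ) (f : F[X] → M) :
    ∑ p ∈ polysLT F (d + 1), f p = ∑ c : F, ∑ p ∈ polysLT F d, f (C c * X ^ d + p) :=
  prod_polysLT_succ F (M := Multiplicative M) d f

theorem sum_monics {M : Type*} [AddCommMonoid M] (d : ℕ) (f : F[X] → M) :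
    ∑ p ∈ monics F d, f p = ∑ p ∈ polysLT F d, f (X ^ d + p) :=
  prod_monics F (M := Multiplicative M) d f

variable {F} in
theorem sub_mem_polysLT {d : ℕ} {a b : F[X]} (ha : a ∈ monics F d) (hb : b ∈ monics F d) :
    a - b ∈ polysLT F d := by
  rw [mem_monics] at ha hb
  rw [mem_polysLT, ← ha.2, ← degree_eq_natDegree ha.1.ne_zero]
  exact degree_sub_lt_left (by rw [degree_eq_natDegree ha.1.ne_zero,
    degree_eq_natDegree hb.1.ne_zero, ha.2, hb.2]) ha.1.ne_zero (by rw [ha.1.leadingCoeff, hb.1.leadingCoeff])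

variable {F} in
theorem add_mem_monics {d : ℕ} {a p : F[X]} (ha : a ∈ monics F d) (hp : p ∈ polysLT F d) :
    a + p ∈ monics F d := by
  rw [mem_monics] at ha ⊢
  rw [mem_polysLT, ← ha.2, ← degree_eq_natDegree ha.1.ne_zero] at hp
  exact ⟨ha.1.add_of_left hp, by
    rw [natDegree_eq_of_degree_eq (degree_add_eq_left_of_degree_lt hp), ha.2]⟩

variable {F} in
theorem sum_monics_sub_right {M : Type*} [AddCommMonoid M] {d : ℕ} {b : F[X]}
    (hb : b ∈ monics F d) (f : F[X] → M) :
    ∑ a ∈ monics F d, f (a - b) = ∑ p ∈ polysLT F d, f p :=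
  Finset.sum_bij' (fun a _ => a - b) (fun p _ => b + p) (fun a ha => sub_mem_polysLT ha hb)
    (fun p hp => add_mem_monics hb hp) (by simp) (by simp) (by simp)

variable {F} in
theorem sum_monics_sub_left {M : Type*} [AddCommMonoid M] {d : ℕ} {a : F[X]}
    (ha : a ∈ monics F d) (f : F[X] → M) :
    ∑ b ∈ monics F d, f (a - b) = ∑ p ∈ polysLT F d, f p :=
  Finset.sum_bij' (fun b _ => a - b) (fun p _ => a - p) (fun b hb => sub_mem_polysLT ha hb)
    (fun p hp => by
      rw [sub_eq_add_neg]
      exact add_mem_monics ha (by simpa using hp)) (by simp) (by simp) (by simp)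

theorem sum_inv_pow_eq (i : ℕ) (hi : 0 < i) : ∑ c : F, (c ^ i)⁻¹ = if q - 1 ∣ i then -1 else 0 := by
  classical
  rw [← FiniteField.sum_pow_units F i, ← Fintype.sum_equiv (Equiv.inv Fˣ) (fun x => ((x : F) ^ i)⁻¹)
    (fun x => (x : F) ^ i) (fun x => by simp)]
  symm
  refine Fintype.sum_of_injective (fun x : Fˣ => (x : F)) Units.val_injective _ _ (fun c hc => ?_)
    fun _ => rfl
  have : c = 0 := by
    by_contra h
    exact hc ⟨Units.mk0 c h, rfl⟩
  simp [this, hi.ne']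

/-- The sum of the inverses of the `i`-th powers of the polynomials of degree `< d`, where
`1 / 0 = 0`. -/
theorem sum_polysLT_inv_pow (d i : ℕ) (hi : 0 < i) :
    ∑ p ∈ polysLT F d, (algebraMap F[X] (RatFunc F) p ^ i)⁻¹ =
      algebraMap F (RatFunc F) (∑ c : F, (c ^ i)⁻¹) * pSumLT F d [i] := by
  classical
  induction d with
  | zero =>
    have : polysLT F 0 = {0} := by
      ext p
      simp [Nat.WithBot.lt_zero_iff]
    simp [this, pSumLT, hi.ne']
  | succ d ih =>
    -- For `c ≠ 0`, dividing by the leading coefficient gives monic polynomials of degree `d` and a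
    -- factor `c ^ (-i)`.
    have h : ∀ c : F, ∑ p ∈ polysLT F d, (algebraMap F[X] (RatFunc F) (C c * X ^ d + p) ^ i)⁻¹ =
        algebraMap F (RatFunc F) ((c ^ i)⁻¹) * pSum F d i +
          if c = 0 then ∑ p ∈ polysLT F d, (algebraMap F[X] (RatFunc F) p ^ i)⁻¹ else 0 := by
      intro c
      split_ifs with hc
      · simp [hc, hi.ne']
      · rw [add_zero, pSum, sum_monics, Finset.mul_sum]
        refine Finset.sum_bij' (fun p _ => C c⁻¹ * p) (fun p _ => C c * p) ?_ ?_ ?_ ?_ ?_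
        · intro p hp
          simpa [hc] using hp
        · intro p hp
          simpa [hc] using hp
        · intro p _
          simp [← mul_assoc, ← C_mul, hc]
        · intro p _
          simp [← mul_assoc, ← C_mul, hc]
        · intro p _
          have h1 : C c * X ^ d + p = C c * (X ^ d + C c⁻¹ * p) := by
            rw [mul_add, ← mul_assoc, ← C_mul, mul_inv_cancel₀ hc, C_1, one_mul]
          rw [h1, map_mul, mul_pow, mul_inv, map_inv₀ (algebraMap F (RatFunc F)),
            map_pow (algebraMap F (RatFunc F)), RatFunc.algebraMap_C,
            RatFunc.algebraMap_eq_C]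
    rw [sum_polysLT_succ, Finset.sum_congr rfl fun c _ => h c, Finset.sum_add_distrib,
      ← Finset.sum_mul, ← map_sum, pSumLT_cons_succ, mul_add, pSumLT, mul_one]
    simp [ih, add_comm]

/-- Sums of `1 / (a ^ r b ^ s (a - b) ^ i)` over monic `a`, `b` of degree `d`,
where `1 / 0 = 0`. -/
def pairSum (r s i d : ℕ) : RatFunc F :=
  ∑ a ∈ monics F d, ∑ b ∈ monics F d, (algebraMap F[X] (RatFunc F) a ^ r)⁻¹ *
    (algebraMap F[X] (RatFunc F) b ^ s)⁻¹ * (algebraMap F[X] (RatFunc F) (a - b) ^ i)⁻¹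

theorem pairSum_zero_left (s d : ℕ) {i : ℕ} (hi : 0 < i) : pairSum F 0 s i d =
    algebraMap F (RatFunc F) (∑ c : F, (c ^ i)⁻¹) * (pSum F d s * pSumLT F d [i]) := by
  rw [pairSum, Finset.sum_comm, pSum, Finset.sum_mul, Finset.mul_sum]
  refine Finset.sum_congr rfl fun b hb => ?_
  simp only [pow_zero, inv_one, one_mul]
  rw [← Finset.mul_sum, sum_monics_sub_right hb fun p => (algebraMap F[X] (RatFunc F) p ^ i)⁻¹,
    sum_polysLT_inv_pow F d i hi]
  ring

theorem pairSum_zero_right (r d : ℕ) {i : ℕ} (hi : 0 < i) : pairSum F r 0 i d =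
    algebraMap F (RatFunc F) (∑ c : F, (c ^ i)⁻¹) * (pSum F d r * pSumLT F d [i]) := by
  rw [pairSum, pSum, Finset.sum_mul, Finset.mul_sum]
  refine Finset.sum_congr rfl fun a ha => ?_
  simp only [pow_zero, inv_one, mul_one]
  rw [← Finset.mul_sum, sum_monics_sub_left ha fun p => (algebraMap F[X] (RatFunc F) p ^ i)⁻¹,
    sum_polysLT_inv_pow F d i hi]
  ring

/-- Partial fractions: `1 / (a b) = (1 / b - 1 / a) / (a - b)`. Diagonal terms vanish because `i >
0` and `1 / 0 = 0`. -/
theorem pairSum_succ_succ (r s d : ℕ) {i : ℕ} (hi : 0 < i) : pairSum F (r + 1) (s + 1) i d =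
    pairSum F r (s + 1) (i + 1) d - pairSum F (r + 1) s (i + 1) d := by
  simp only [pairSum, ← Finset.sum_sub_distrib]
  refine Finset.sum_congr rfl fun a ha => Finset.sum_congr rfl fun b hb => ?_
  rcases eq_or_ne a b with rfl | hab
  · simp [hi.ne']
  · have h1 : algebraMap F[X] (RatFunc F) a ≠ 0 :=
      RatFunc.algebraMap_ne_zero (mem_monics.1 ha).1.ne_zero
    have h2 : algebraMap F[X] (RatFunc F) b ≠ 0 :=
      RatFunc.algebraMap_ne_zero (mem_monics.1 hb).1.ne_zero
    have h3 : algebraMap F[X] (RatFunc F) a - algebraMap F[X] (RatFunc F) b ≠ 0 := by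
      rw [← map_sub]
      exact RatFunc.algebraMap_ne_zero (sub_ne_zero.2 hab)
    rw [map_sub]
    field_simp
    ring

theorem pSum_mul_pSum (r s d : ℕ) : pSum F d (r + 1) * pSum F d (s + 1) =
    pSum F d (r + 1 + (s + 1)) + (pairSum F r (s + 1) 1 d - pairSum F (r + 1) s 1 d) := by
  classical
  simp only [pairSum, ← Finset.sum_sub_distrib]
  rw [pSum, pSum, pSum, Finset.sum_mul_sum, ← Finset.sum_add_distrib]
  refine Finset.sum_congr rfl fun a ha => ?_
  have h0 : (algebraMap F[X] (RatFunc F) a ^ (r + 1 + (s + 1)))⁻¹ = ∑ b ∈ monics F d,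
      if a = b then (algebraMap F[X] (RatFunc F) a ^ (r + 1 + (s + 1)))⁻¹ else 0 := by simp [ha]
  rw [h0, ← Finset.sum_add_distrib]
  refine Finset.sum_congr rfl fun b hb => ?_
  have h1 : algebraMap F[X] (RatFunc F) a ≠ 0 :=
    RatFunc.algebraMap_ne_zero (mem_monics.1 ha).1.ne_zero
  rcases eq_or_ne a b with rfl | hab
  · simp [pow_add, mul_comm]
  · have h2 : algebraMap F[X] (RatFunc F) b ≠ 0 :=
      RatFunc.algebraMap_ne_zero (mem_monics.1 hb).1.ne_zero
    have h3 : algebraMap F[X] (RatFunc F) a - algebraMap F[X] (RatFunc F) b ≠ 0 := by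
      rw [← map_sub]
      exact RatFunc.algebraMap_ne_zero (sub_ne_zero.2 hab)
    rw [map_sub, if_neg hab]
    field_simp
    ring

/-- The `𝔽_p`-combinations of the functions `d ↦ S_d(m) S_{<d}(n)` with `m + n = w`. -/
def depthTwoSpan (w : ℕ) : AddSubgroup (ℕ → RatFunc F) :=
  AddSubgroup.closure {f | ∃ m n, 0 < m ∧ 0 < n ∧ m + n = w ∧
    f = fun d => pSum F d m * pSumLT F d [n]}

/-- The `𝔽_p`-combinations of the functions `d ↦ S_d(n₁, …, n_r)` of weight `w`. -/
def powerSumSpan (w : ℕ) : AddSubgroup (ℕ → RatFunc F) :=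
  AddSubgroup.closure {f | ∃ n t, n :: t ∈ compositions w ∧
    f = fun d => pSum F d n * pSumLT F d t}

/-- The `𝔽_p`-combinations of the functions `d ↦ S_{<d}(n₁, …, n_r)` of weight `w`. -/
def powerSumLTSpan (w : ℕ) : AddSubgroup (ℕ → RatFunc F) :=
  AddSubgroup.closure {f | ∃ t ∈ compositions w, f = fun d => pSumLT F d t}

/-- The character sum is `-1` or `0`, so additive subgroups suffice and coefficients stay in the
prime field. -/
theorem algebraMap_sum_inv_pow_mul_mem {i : ℕ} (hi : 0 < i) {V : AddSubgroup (ℕ → RatFunc F)}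
    {f : ℕ → RatFunc F} (hf : f ∈ V) :
    (fun d => algebraMap F (RatFunc F) (∑ c : F, (c ^ i)⁻¹) * f d) ∈ V := by
  rw [sum_inv_pow_eq F i hi]
  split_ifs
  · convert! V.neg_mem hf using 1
    ext d
    simp
  · convert! V.zero_mem using 1
    ext d
    simp

/-- Partial fractions lower `r + s` until one exponent is zero; then `a - b` runs freely over the
polynomials of degree `< d`. -/
theorem pairSum_mem (r s : ℕ) {i : ℕ} (hi : 0 < i) (hrs : 0 < r + s) :
    pairSum F r s i ∈ depthTwoSpan F (r + s + i) := by
  have main : ∀ N r s i, r + s = N → 0 < i → 0 < r + s →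
      pairSum F r s i ∈ depthTwoSpan F (r + s + i) := by
    intro N
    induction N with
    | zero => intro r s i h _ h'; omega
    | succ N ih =>
      intro r s i h hi hrs
      rcases r with _ | r
      · rw [show pairSum F 0 s i = _ from funext fun d => pairSum_zero_left F s d hi]
        exact algebraMap_sum_inv_pow_mul_mem F hi
          (AddSubgroup.subset_closure ⟨s, i, by omega, hi, by omega, rfl⟩)
      rcases s with _ | s
      · rw [show pairSum F (r + 1) 0 i = _ from funext fun d => pairSum_zero_right F (r + 1) d hi]
        exact algebraMap_sum_inv_pow_mul_mem F hi
          (AddSubgroup.subset_closure ⟨r + 1, i, by omega, hi, by omega, rfl⟩)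
      rw [show pairSum F (r + 1) (s + 1) i = _ from funext fun d => pairSum_succ_succ F r s d hi]
      have h1 := ih r (s + 1) (i + 1) (by omega) (by omega) (by omega)
      have h2 := ih (r + 1) s (i + 1) (by omega) (by omega) (by omega)
      rw [show r + (s + 1) + (i + 1) = r + 1 + (s + 1) + i by omega] at h1
      rw [show r + 1 + s + (i + 1) = r + 1 + (s + 1) + i by omega] at h2
      exact AddSubgroup.sub_mem _ h1 h2
  exact main _ r s i rfl hi hrs

theorem exists_pSum_mul_pSum_eq {r s : ℕ} (hr : 0 < r) (hs : 0 < s) :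
    ∃ g ∈ depthTwoSpan F (r + s), ∀ d, pSum F d r * pSum F d s = pSum F d (r + s) + g d := by
  obtain ⟨r, rfl⟩ : ∃ m, r = m + 1 := ⟨r - 1, by omega⟩
  obtain ⟨s, rfl⟩ : ∃ m, s = m + 1 := ⟨s - 1, by omega⟩
  refine ⟨(pairSum F r (s + 1) 1 - pairSum F (r + 1) s 1 : ℕ → RatFunc F),
    AddSubgroup.sub_mem _ ?_ ?_, fun d => ?_⟩
  · rw [show r + 1 + (s + 1) = r + (s + 1) + 1 by omega]
    exact pairSum_mem F r (s + 1) Nat.one_pos (by omega)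
  · rw [show r + 1 + (s + 1) = r + 1 + s + 1 by omega]
    exact pairSum_mem F (r + 1) s Nat.one_pos (by omega)
  · rw [Pi.sub_apply]
    exact pSum_mul_pSum F r s d

theorem map_mem_of_mem_closure {A B : Type*} [AddCommGroup A] [AddCommGroup B] (φ : A →+ B)
    {S : Set A} {V : AddSubgroup B} (h : ∀ x ∈ S, φ x ∈ V) {x : A}
    (hx : x ∈ AddSubgroup.closure S) : φ x ∈ V :=
  (AddSubgroup.closure_le (V.comap φ)).2 h hx

variable {F} in
theorem pSum_mul_mem {n w : ℕ} (hn : 0 < n) {f : ℕ → RatFunc F} (hf : f ∈ powerSumLTSpan F w) :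
    (fun d => pSum F d n * f d) ∈ powerSumSpan F (n + w) := by
  refine map_mem_of_mem_closure (AddMonoidHom.mulLeft fun d => pSum F d n) ?_ hf
  rintro f ⟨t, ht, rfl⟩
  refine AddSubgroup.subset_closure ⟨n, t, ⟨?_, by simp [ht.2]⟩, rfl⟩
  simpa using ⟨hn, ht.1⟩

variable {F} in
theorem sum_range_mem {w : ℕ} {f : ℕ → RatFunc F} (hf : f ∈ powerSumSpan F w) :
    (fun d => ∑ e ∈ Finset.range d, f e) ∈ powerSumLTSpan F w := by
  let φ : (ℕ → RatFunc F) →+ (ℕ → RatFunc F) :=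
    { toFun := fun f d => ∑ e ∈ Finset.range d, f e
      map_zero' := by ext; simp
      map_add' := fun f g => by ext; simp [Finset.sum_add_distrib] }
  refine map_mem_of_mem_closure φ ?_ hf
  rintro f ⟨n, t, ht, rfl⟩
  exact AddSubgroup.subset_closure ⟨n :: t, ht, rfl⟩

/-- The hypothesis `h` absorbs the depth-two terms `S_d(m) S_{<d}(n)`; it is the induction
hypothesis of `pSumLT_singleton_mul_mem`. -/
theorem pSum_mul_pSum_mul_mem {t : List ℕ} (ht : ∀ n ∈ t, 0 < n)
    (h : ∀ i, 0 < i → (fun d => pSumLT F d [i] * pSumLT F d t) ∈ powerSumLTSpan F (i + t.sum))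
    {r s : ℕ} (hr : 0 < r) (hs : 0 < s) :
    (fun d => pSum F d r * pSum F d s * pSumLT F d t) ∈ powerSumSpan F (r + s + t.sum) := by
  obtain ⟨g, hg, hg'⟩ := exists_pSum_mul_pSum_eq F hr hs
  have h1 : (fun d => pSum F d (r + s) * pSumLT F d t) ∈ powerSumSpan F (r + s + t.sum) :=
    pSum_mul_mem (by omega) (AddSubgroup.subset_closure ⟨t, ⟨ht, rfl⟩, rfl⟩)
  have h2 : (fun d => g d * pSumLT F d t) ∈ powerSumSpan F (r + s + t.sum) := by
    refine map_mem_of_mem_closure (AddMonoidHom.mulRight fun d => pSumLT F d t) ?_ hg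
    rintro f ⟨m, n, hm, hn, hmn, rfl⟩
    rw [← hmn, add_assoc]
    convert! pSum_mul_mem hm (h n hn) using 1
    ext d
    exact mul_assoc _ _ _
  convert! AddSubgroup.add_mem _ h1 h2 using 1
  ext d
  simp only [hg', add_mul, Pi.add_apply]

theorem sum_range_mul_sum_range {A : Type*} [CommRing A] (u v : ℕ → A) (d : ℕ) :
    (∑ e ∈ Finset.range d, u e) * ∑ e ∈ Finset.range d, v e =
      ∑ e ∈ Finset.range d, (u e * ∑ e' ∈ Finset.range e, v e' +
        v e * (∑ e' ∈ Finset.range e, u e') + u e * v e) := by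
  induction d with
  | zero => simp
  | succ d ih =>
    rw [Finset.sum_range_succ, Finset.sum_range_succ, Finset.sum_range_succ, ← ih]
    ring

theorem pSumLT_singleton_mul_mem (t : List ℕ) (ht : ∀ n ∈ t, 0 < n) (i : ℕ) (hi : 0 < i) :
    (fun d => pSumLT F d [i] * pSumLT F d t) ∈ powerSumLTSpan F (i + t.sum) := by
  induction t generalizing i with
  | nil =>
    exact AddSubgroup.subset_closure ⟨[i], ⟨by simpa using hi, by simp⟩, by simp [pSumLT]⟩
  | cons n t ih =>
    have hn : 0 < n := ht n (by simp)
    have ht' : ∀ n ∈ t, 0 < n := fun m hm => ht m (by simp [hm])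
    have h1 : (fun d => pSum F d i * pSumLT F d (n :: t)) ∈ powerSumSpan F (i + (n :: t).sum) :=
      pSum_mul_mem hi (AddSubgroup.subset_closure ⟨n :: t, ⟨ht, rfl⟩, rfl⟩)
    have h2 := pSum_mul_mem hn (ih ht' i hi)
    have h3 := pSum_mul_pSum_mul_mem F ht' (ih ht') hi hn
    rw [show n + (i + t.sum) = i + (n :: t).sum by simp; omega] at h2
    rw [show i + n + t.sum = i + (n :: t).sum by simp; omega] at h3
    -- The three terms correspond to the leading degree of `i` being larger than, smaller than or
    -- equal to that of `n`.
    convert! sum_range_mem (AddSubgroup.add_mem _ (AddSubgroup.add_mem _ h1 h2) h3) using 2 with d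
    simp only [pSumLT, mul_one, Pi.add_apply]
    rw [sum_range_mul_sum_range]
    refine Finset.sum_congr rfl fun e _ => ?_
    ring

theorem pSum_mul_pSum_mul_pSumLT_mem {n m : ℕ} {t : List ℕ} (hn : 0 < n) (hm : 0 < m)
    (ht : ∀ i ∈ t, 0 < i) :
    (fun d => pSum F d n * (pSum F d m * pSumLT F d t)) ∈ powerSumSpan F (n + m + t.sum) := by
  simpa only [mul_assoc] using
    pSum_mul_pSum_mul_mem F ht (pSumLT_singleton_mul_mem F t ht) hn hm

variable [DecidableEq (RatFunc F)]

variable {F} in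
-- The span consists of functions of `d`, so one formal combination serves all `d` at once.
theorem exists_powerSumMap_eq {w : ℕ} {f : ℕ → RatFunc F} (hf : f ∈ powerSumSpan F w) :
    ∃ L ∈ formalSpace F w, (∀ s, L s ∈ (⊥ : Subfield (RatFunc F))) ∧
      ∀ d, powerSumMap F d L = algebraMap (RatFunc F) (Kinf F) (f d) := by
  induction hf using AddSubgroup.closure_induction with
  | mem f h =>
    obtain ⟨n, t, ht, rfl⟩ := h
    refine ⟨Finsupp.single (n :: t) 1, Finsupp.single_mem_supported _ _ ht, fun s => ?_,
      fun d => ?_⟩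
    · classical
      rw [Finsupp.single_apply]
      split_ifs
      exacts [Subfield.one_mem _, Subfield.zero_mem _]
    · rw [powerSumMap, Finsupp.linearCombination_single, one_smul, powerSum_cons]
  | zero => exact ⟨0, Submodule.zero_mem _, fun s => Subfield.zero_mem _, fun d => by simp⟩
  | add f g _ _ hf hg =>
    obtain ⟨L, h1, h2, h3⟩ := hf
    obtain ⟨L', h1', h2', h3'⟩ := hg
    exact ⟨L + L', Submodule.add_mem _ h1 h1', fun s => Subfield.add_mem _ (h2 s) (h2' s),
      fun d => by rw [map_add, h3, h3', Pi.add_apply, map_add]⟩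
  | neg f _ hf =>
    obtain ⟨L, h1, h2, h3⟩ := hf
    exact ⟨-L, Submodule.neg_mem _ h1, fun s => Subfield.neg_mem _ (h2 s),
      fun d => by rw [map_neg, h3, Pi.neg_apply, map_neg]⟩

end Expansion

/-! ### Weights, non-triviality and the expansion of `Ξ_k` -/

section Main

theorem pow_add_sum_block {q : ℕ} (hq : 0 < q) (m n : ℕ) :
    q ^ m + (block q m n).sum = q ^ (m + n) := by
  induction n generalizing m with
  | zero => simp [block]
  | succ n ih =>
    obtain ⟨r, rfl⟩ := Nat.exists_eq_add_of_lt hq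
    rw [block_succ, List.sum_cons, ← add_assoc, add_comm ((0 + r + 1) ^ m), ← Nat.mul_succ,
      show (0 + r + 1 - 1).succ = 0 + r + 1 by omega, ← pow_succ, ih,
      show m + 1 + n = m + (n + 1) by omega]

theorem block_pos {q : ℕ} (hq : 1 < q) (m n : ℕ) : ∀ i ∈ block q m n, 0 < i := by
  simp only [block, List.mem_map]
  rintro _ ⟨i, _, rfl⟩
  exact Nat.mul_pos (Nat.pow_pos (by omega)) (by omega)

variable (F : Type*) [Field F]

variable {F} in
theorem pos_of_mem_formalSpace {w : ℕ} {L : List ℕ →₀ RatFunc F} (hL : L ∈ formalSpace F w) :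
    ∀ s ∈ L.support, ∀ n ∈ s, 0 < n :=
  fun _ hs => (((Finsupp.mem_supported _ _).1 hL) (Finset.mem_coe.2 hs)).1

theorem single_mem_formalSpace {w : ℕ} {s : List ℕ} (hs : s ∈ compositions w) (c : RatFunc F) :
    Finsupp.single s c ∈ formalSpace F w :=
  Finsupp.single_mem_supported _ _ hs

section

variable [Fintype F]

local notation "q" => Fintype.card F

theorem pSum_mul_pSumLT_block (d k j : ℕ) :
    pSum F d (q ^ (k - j)) * pSumLT F d (block q (k - j) j) =
      (pSum F d 1 * pSumLT F d (block q 0 j)) ^ q ^ (k - j) := by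
  have h := map_mul_block q 0 (k - j) j
  rw [add_zero] at h
  rw [← h, pSumLT_map_mul, mul_pow]
  congr 1
  simpa using pSum_mul_card_pow F d 1 (k - j)

/-- The `ε j` will be the unknown coefficients of `[1, q^k]` in the `L_j`; it matters only that they
are constants in `θ`. -/
theorem relation_coeff_ne_zero {k : ℕ} {ε : ℕ → RatFunc F}
    (hε : ∀ j ∈ Finset.Icc 1 k, ε j ∈ (⊥ : Subfield (RatFunc F))) :
    (-1) ^ (k + 1) / carlitzD F k + ∑ j ∈ Finset.Icc 1 k, xiCoeff F k j * ε j ≠ 0 := by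
  have h1 : ∀ j, ∃ e : F, j ∈ Finset.Icc 1 k → algebraMap F (RatFunc F) e = ε j := fun j => by
    by_cases hj : j ∈ Finset.Icc 1 k
    · obtain ⟨e, he⟩ := (bot_le : ⊥ ≤ (algebraMap F (RatFunc F)).fieldRange) (hε j hj)
      exact ⟨e, fun _ => he⟩
    · exact ⟨0, fun h => absurd h hj⟩
  choose e he using h1
  have hk := carlitzD_ne_zero F k
  intro h
  have hD : ∀ j, algebraMap F[X] (RatFunc F) (carlitzDAt F X j) = carlitzD F j := fun j => by
    simp [carlitzDAt, carlitzD]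
  have h2 : algebraMap F[X] (RatFunc F) ((-1) ^ (k + 1) + ∑ j ∈ Finset.Icc 1 k,
      (-1) ^ (k + j) * carlitzDAt F X j ^ q ^ (k - j) * C (e j)) = 0 := by
    rw [← mul_zero (carlitzD F k), ← h, mul_add, Finset.mul_sum, map_add, map_sum]
    congr 1
    · simp [mul_div_cancel₀ _ hk]
    · refine Finset.sum_congr rfl fun j hj => ?_
      rw [map_mul, map_mul, map_pow, map_pow, hD, RatFunc.algebraMap_C, ← RatFunc.algebraMap_eq_C,
        he j hj, xiCoeff, map_neg, map_one]
      field_simp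
  -- With `D_k` cleared the identity lives in `F[θ]` and can be evaluated at `θ = 0`.
  rw [map_eq_zero_iff _ (RatFunc.algebraMap_injective F)] at h2
  have h3 := congrArg (eval 0) h2
  have h4 : ∀ j ∈ Finset.Icc 1 k, eval 0 (carlitzDAt F (X : F[X]) j) = 0 := fun j hj => by
    rw [carlitzDAt, eval_prod]
    refine Finset.prod_eq_zero (Finset.mem_range.2 (Finset.mem_Icc.1 hj).1) ?_
    simp [Fintype.card_ne_zero]
  rw [eval_add, eval_finsetSum, Finset.sum_eq_zero] at h3
  · simp at h3
  · intro j hj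
    simp [h4 j hj, Fintype.card_ne_zero]

end

variable [DecidableEq (RatFunc F)]

variable {F} in
theorem zetaMap_mem_mzvSpace {w : ℕ} {L : List ℕ →₀ RatFunc F} (hL : L ∈ formalSpace F w) :
    zetaMap F L ∈ mzvSpace F w :=
  (Finsupp.mem_span_image_iff_linearCombination _).2 ⟨L, hL, rfl⟩

variable [Fintype F]

local notation "q" => Fintype.card F

theorem powerSum_mul_powerSum_xiTuple (d k j : ℕ) :
    powerSum F d [1] * powerSum F d (xiTuple q k j) = algebraMap (RatFunc F) (Kinf F)
      (pSum F d 1 * (pSum F d (q ^ (k - j)) * pSumLT F d (block q (k - j) j))) := by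
  rw [powerSum_singleton, xiTuple, powerSum_cons, ← map_mul (algebraMap (RatFunc F) (Kinf F))]

theorem exists_xi_expansion {k j : ℕ} (hj : j ≤ k) : ∃ L ∈ formalSpace F (q ^ k + 1),
    (∀ s, L s ∈ (⊥ : Subfield (RatFunc F))) ∧
      ∀ d, powerSumMap F d L = powerSum F d [1] * powerSum F d (xiTuple q k j) := by
  have h1 := pSum_mul_pSum_mul_pSumLT_mem F (m := q ^ (k - j)) one_pos
    (Nat.pow_pos Fintype.card_pos) (block_pos (Fintype.one_lt_card (α := F)) (k - j) j)
  rw [add_assoc, pow_add_sum_block Fintype.card_pos, Nat.sub_add_cancel hj, add_comm] at h1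
  simp_rw [powerSum_mul_powerSum_xiTuple]
  exact exists_powerSumMap_eq h1

end Main

end

end ThakurMZV

open ThakurMZV in
theorem theorem7p4 (F : Type*) [Field F] [Fintype F] [DecidableEq (RatFunc F)]
    (q : ℕ) (hq : q = Fintype.card F) (k : ℕ) (hk : 0 < k) :
    -- all the series involved converge
    (∀ w : ℕ, ∀ s ∈ compositions w, Summable fun a : tuples F s.length => term F s a) ∧
    (∀ j ∈ Finset.Icc 1 k,
      Summable fun d : ℕ => powerSum F d [1] * powerSum F d (xiTuple q k j)) ∧
    -- the relation in `K_∞`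
    xi F k ∈ mzvSpace F (q ^ k + 1) ∧
    zeta F (1 :: 1 :: block q 0 k) + ((-1) ^ (k + 1) / carlitzD F k) • zeta F [1, q ^ k]
      + xi F k = 0 ∧
    -- it comes from a nonzero formal `K`-linear combination of symbols of weight `q ^ k + 1`,
    -- where each product `S_d(1) S_d(…)` is expanded, uniformly in `d`, over the prime field
    ∃ L : ℕ → (List ℕ →₀ RatFunc F),
      (∀ j ∈ Finset.Icc 1 k,
        L j ∈ formalSpace F (q ^ k + 1) ∧ (∀ s, L j s ∈ (⊥ : Subfield (RatFunc F))) ∧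
        ∀ d : ℕ, powerSumMap F d (L j) = powerSum F d [1] * powerSum F d (xiTuple q k j)) ∧
      zetaMap F (∑ j ∈ Finset.Icc 1 k, xiCoeff F k j • L j) = xi F k ∧
      ∃ R ∈ formalSpace F (q ^ k + 1),
        R = Finsupp.single (1 :: 1 :: block q 0 k) 1
          + Finsupp.single [1, q ^ k] ((-1) ^ (k + 1) / carlitzD F k)
          + ∑ j ∈ Finset.Icc 1 k, xiCoeff F k j • L j ∧
        R ≠ 0 ∧ zetaMap F R = 0 := by
  subst hq
  have hL : ∀ j, ∃ L : List ℕ →₀ RatFunc F, j ∈ Finset.Icc 1 k →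
      L ∈ formalSpace F (Fintype.card F ^ k + 1) ∧
      (∀ s, L s ∈ (⊥ : Subfield (RatFunc F))) ∧
      ∀ d, powerSumMap F d L = powerSum F d [1] * powerSum F d (xiTuple (Fintype.card F) k j) := by
    intro j
    by_cases hj : j ∈ Finset.Icc 1 k
    · obtain ⟨L, h⟩ := exists_xi_expansion F (Finset.mem_Icc.1 hj).2
      exact ⟨L, fun _ => h⟩
    · exact ⟨0, fun h => absurd h hj⟩
  choose L hL using hL
  have hsum : ∀ j ∈ Finset.Icc 1 k, HasSum (fun d : ℕ => powerSum F d [1] *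
      powerSum F d (xiTuple (Fintype.card F) k j)) (zetaMap F (L j)) := fun j hj => by
    have := hasSum_powerSumMap (L j) (pos_of_mem_formalSpace (hL j hj).1)
    simpa only [(hL j hj).2.2] using this
  have hX : zetaMap F (∑ j ∈ Finset.Icc 1 k, xiCoeff F k j • L j) = xi F k := by
    rw [map_sum, xi]
    refine Finset.sum_congr rfl fun j hj => ?_
    rw [map_smul, (hsum j hj).tsum_eq]
  have hXmem : ∑ j ∈ Finset.Icc 1 k, xiCoeff F k j • L j ∈ formalSpace F (Fintype.card F ^ k + 1) :=
    Submodule.sum_mem _ fun j hj => Submodule.smul_mem _ _ (hL j hj).1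
  have hw1 : 1 :: 1 :: block (Fintype.card F) 0 k ∈ compositions (Fintype.card F ^ k + 1) := by
    refine ⟨?_, ?_⟩
    · simpa using block_pos Fintype.one_lt_card 0 k
    · have := pow_add_sum_block (Fintype.card_pos (α := F)) 0 k
      rw [pow_zero, zero_add] at this
      rw [List.sum_cons, List.sum_cons, this, add_comm]
  have hw2 : [1, Fintype.card F ^ k] ∈ compositions (Fintype.card F ^ k + 1) :=
    ⟨by simp [Fintype.card_pos], by simp [add_comm]⟩
  set R : List ℕ →₀ RatFunc F := Finsupp.single (1 :: 1 :: block (Fintype.card F) 0 k) 1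
    + Finsupp.single [1, Fintype.card F ^ k] ((-1) ^ (k + 1) / carlitzD F k)
    + ∑ j ∈ Finset.Icc 1 k, xiCoeff F k j • L j with hR
  have hRmem : R ∈ formalSpace F (Fintype.card F ^ k + 1) :=
    Submodule.add_mem _ (Submodule.add_mem _ (single_mem_formalSpace F hw1 _)
      (single_mem_formalSpace F hw2 _)) hXmem
  -- This is `pSumLT_relation` multiplied by `S_d(1)`.
  have hRsum : ∀ d, powerSumMap F d R = 0 := by
    intro d
    have h1 := congrArg (fun x => algebraMap (RatFunc F) (Kinf F) (pSum F d 1 * x))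
      (pSumLT_relation F d k)
    rw [mul_zero, map_zero, mul_add, mul_add, map_add, map_add] at h1
    rw [hR, map_add, map_add, map_sum, ← h1]
    congr 1
    · congr 1
      · rw [powerSumMap, Finsupp.linearCombination_single, one_smul, powerSum_cons]
      · rw [powerSumMap, Finsupp.linearCombination_single, powerSum_cons, Algebra.smul_def,
          ← map_mul]
        congr 1
        ring
    · rw [Finset.mul_sum, map_sum]
      refine Finset.sum_congr rfl fun j hj => ?_
      rw [map_smul, (hL j hj).2.2, powerSum_mul_powerSum_xiTuple, pSum_mul_pSumLT_block,
        Algebra.smul_def, ← map_mul]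
      congr 1
      ring
  have hRzero : zetaMap F R = 0 := by
    have h := hasSum_powerSumMap R (pos_of_mem_formalSpace hRmem)
    simp only [hRsum] at h
    exact h.unique hasSum_zero
  refine ⟨fun w s hs => summable_term s hs.1, fun j hj => (hsum j hj).summable,
    hX ▸ zetaMap_mem_mzvSpace hXmem, ?_, L, hL, hX, R, hRmem, rfl, ?_, hRzero⟩
  · rw [← hX, ← hRzero, hR, map_add, map_add]
    simp [zetaMap, Finsupp.linearCombination_single]
  · intro h
    have h1 := DFunLike.congr_fun h [1, Fintype.card F ^ k]
    -- The lengths `k + 2` and `2` differ because `k > 0`.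
    have hne : 1 :: 1 :: block (Fintype.card F) 0 k ≠ [1, Fintype.card F ^ k] := fun h => by
      have := congrArg List.length h
      simp [block] at this
      omega
    refine relation_coeff_ne_zero F (ε := fun j => L j [1, Fintype.card F ^ k])
      (fun j hj => (hL j hj).2.1 _) ?_
    refine Eq.trans ?_ h1
    rw [hR, Finsupp.add_apply, Finsupp.add_apply, Finsupp.single_eq_of_ne hne.symm,
      Finsupp.single_eq_same, zero_add, Finsupp.finsetSum_apply]
    simp only [Finsupp.smul_apply, smul_eq_mul]
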